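/- **Soundness of BMDP abstractions.** *Controlled Markov systems.* A controlled Markov system $(\mathcal X,\mathcal U,\{[\![\Theta^u]\!]\}_{u\in\mathcal U},\mathrm{AP},L)$ consists of a state space $\mathcal X=\mathcal W\cup\Delta$ (working space $\mathcal W$, out-of-domain states $\Delta=\mathcal W^c$), an action space $\mathcal U$, for each $u\in\mathcal U$ a collection $[\![\Theta^u]\!]$ of stochastic kernels on $\mathcal X$, a finite set $\mathrm{AP}$, and a Borel labelling $L:\mathcal X\to 2^{\mathrm{AP}}$. A deterministic admissible policy $\kappa$ is a sequence of measurable maps $\kappa_t$ giving the action $\mathfrak u_t=\kappa_t(X_{[0,t]},\mathfrak u_{[0,t-1]})$. A process generated by the system under $\kappa$ from an initial distribution $\nu$ is a process $(X_t,\mathfrak u_t)_{t\in\mathbb N}$ such that $X_0\sim\nu$, almost surely $\mathfrak u_t=\kappa_t(X_{[0,t]},\mathfrak u_{[0,t-1]})$ for all $t$, and for every $t$ the conditional law of $X_{t+1}$ given $(X_{[0,t]},\mathfrak u_{[0,t]})$ is $\Theta(X_t,\cdot)$ for some $\Theta\in[\![\Theta^{\mathfrak u_t}]\!]$; the choice of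 $\Theta$ may depend on $t$ and on the realized history, provided that the conditional law depends measurably on the history. The set of generated processes carries the policy as a superscript. A process satisfies $\Psi\subseteq(2^{\mathrm{AP}})^\omega$, written $X\vDash\Psi$, when $L(X_0)L(X_1)\cdots\in\Psi$; $\Psi$ is $\omega$-regular if it is the language of a finite nondeterministic Büchi automaton. *Concrete system.* Let $f:\mathbb R^n\times\mathbb R^p\to\mathbb R^n$ and $b:\mathbb R^n\to\mathbb R^{n\times k}$ be locally Lipschitz, $\vartheta\ge 0$, $\mathcal U\subset\mathbb R^p$ compact, $\mathcal W\subset\mathbb R^n$ bounded and Borel, and $L:\mathbb R^n\to 2^{\mathrm{AP}}$ Borel. Let $\mathbb{XU}$ be the controlled Markov system on $\mathbb R^n$ of $$X_{t+1}=f(X_t,\mathfrak u_t)+b(X_t)\mathbf w_t+\vartheta\,\xi_t$$ stopped on leaving $\mathcal W$: $[\![\mathcal T^u]\!]$ consists of the kernels $\mathcal T^u$ for which there is a probability law $\rho$ on $\mathbb R^n$ with $\int|\xi|_\infty\,d\rho\le 1$ such that, for $x\in\mathcal W$, $\mathcal T^u(x,\cdot)$ is the law of $f(x,u)+b(x)w+\vartheta\xi$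 with independent $w\sim\mathcal N(0,I_k)$ and $\xi\sim\rho$, and $\mathcal T^u(x,\cdot)=\delta_x$ for $x\notin\mathcal W$. *BMDP.* Let $\mathcal Q$ be a finite set with a distinguished out-of-domain state $\Delta$, $Act$ a finite set, $\check\Theta^a,\hat\Theta^a$ ($a\in Act$) real $\mathcal Q\times\mathcal Q$ matrices, and $L_{\mathbb{IA}}:\mathcal Q\to2^{\mathrm{AP}}$. Let $\mathbb{IA}$ be the controlled Markov system on $\mathcal Q$ with $[\![\Theta^a]\!]=\{\Theta\text{ stochastic}:\check\Theta^a\le\Theta\le\hat\Theta^a\text{ entrywise}\}$. *Abstraction.* Let $\alpha\subseteq\mathbb R^n\times\mathcal Q$ come from a partition: every $x$ is related to exactly one $q$, the cells $\alpha^{-1}(q)$ are Borel, and $\alpha^{-1}(\Delta)=\mathcal W^c$. Let $\Sigma_\alpha\subseteq\mathfrak P(\mathbb R^n)\times\mathfrak P(\mathcal Q)$. Say that $u\in\mathcal U$ matches $a\in Act$ at $q_i$ if for every $\mathcal T^u\in[\![\mathcal T^u]\!]$ and every $x\in\alpha^{-1}(q_i)$ there is $\Theta^a\in[\![\Theta^a]\!]$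 with $(\mathcal T^u(x,\cdot),\Theta^a_i)\in\Sigma_\alpha$ and $\mathcal T^u(x,\alpha^{-1}(q_j))=\Theta^a_{ij}$ for all $j$. Suppose $\mathbb{XU}\preceq_{\Sigma_\alpha}\mathbb{IA}$, that is, every $x$ is related to some $q$ with $L_{\mathbb{IA}}(q)=L(x)$, and for all $q_i\in\mathcal Q$ and $a\in Act$ some $u\in\mathcal U$ matches $a$ at $q_i$. A policy $\phi$ of $\mathbb{XU}$ is a $\Sigma_\alpha$-implementation of a policy $\kappa$ of $\mathbb{IA}$ if, at every time $t$ and for all paths $x_{[0,t]}$ and $q_{[0,t]}$ with $x_s\in\alpha^{-1}(q_s)$ for $s\le t$, the control $u_t$ that $\phi$ realizes along $x_{[0,t]}$ matches, at $q_t$, the action $a_t$ that $\kappa$ realizes along $q_{[0,t]}$. **Theorem.** Let $\nu_0$ be a probability measure on $\mathbb R^n$ with $\nu_0(\alpha^{-1}(q_0))=1$, and let $\kappa$ be a deterministic admissible policy of $\mathbb{IA}$. Then there is a deterministic admissible policy $\phi$ of $\mathbb{XU}$ that is a $\Sigma_\alpha$-implementation of $\kappa$ and such that, for every process $X^\phi\in\mathbb{XU}^\phi$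 with initial distribution $\nu_0$ and every $\omega$-regular $\Psi\subseteq(2^{\mathrm{AP}})^\omega$, the set $\Psi$ is Borel and $$\mathbf P_X^{\nu_0,\phi}(X^\phi\vDash\Psi)\in\bigl\{\mathcal P_I^{q_0,\kappa}(I^\kappa\vDash\Psi)\bigr\}_{I^\kappa\in\mathbb{IA}^\kappa},$$ where $I^\kappa$ ranges over the processes generated by $\mathbb{IA}$ under $\kappa$ from the initial state $q_0$. -/

import Mathlib

open MeasureTheory ProbabilityTheory

/-! ### Controlled Markov systems -/

/-- Markov (that is, stochastic) kernels from `X` to `Y`. On a finite discrete space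
`MarkovKernel Q Q` is the set of stochastic matrices, see `MarkovKernel.toMatrix`. -/
abbrev MarkovKernel (X Y : Type*) [MeasurableSpace X] [MeasurableSpace Y] :=
  {T : Kernel X Y // IsMarkovKernel T}

/-- The probability measure `T(x, ·)`. -/
def MarkovKernel.row {X Y : Type*} [MeasurableSpace X] [MeasurableSpace Y]
    (T : MarkovKernel X Y) (x : X) : ProbabilityMeasure Y :=
  ⟨T.1 x, T.2.isProbabilityMeasure x⟩

/-- The matrix of transition probabilities of a Markov kernel on a discrete space. -/
noncomputable def MarkovKernel.toMatrix {Q : Type*} [MeasurableSpace Q]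
    (T : MarkovKernel Q Q) : Matrix Q Q ℝ :=
  fun i j => (T.1 i).real {j}

/-- A controlled Markov system with states `X`, actions `U` and atomic propositions `AP`: a working
space `W` (the out-of-domain states are those of `Wᶜ`), for each action a collection of transition
kernels, and a measurable labelling function. -/
structure ControlledMarkovSystem (X U AP : Type*) [MeasurableSpace X] where
  W : Set X
  trans : U → Set (MarkovKernel X X)
  label : X → Set AP
  measurable_label : Measurable label

/-- A deterministic admissible control policy: at each time `t` the action is a measurable function
of `X_0, …, X_t` and of the previous actions `u_0, …, u_{t-1}`. -/
structure Policy (X U : Type*) [MeasurableSpace X] [MeasurableSpace U] where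
  act : (t : ℕ) → (Fin (t + 1) → X) → (Fin t → U) → U
  measurable_act : ∀ t, Measurable fun h : (Fin (t + 1) → X) × (Fin t → U) => act t h.1 h.2

/-- The control that a policy prescribes at time `t` along a path of states and controls. -/
def Policy.at {X U : Type*} [MeasurableSpace X] [MeasurableSpace U] (φ : Policy X U)
    (t : ℕ) (x : ℕ → X) (u : ℕ → U) : U :=
  φ.act t (fun s => x s) (fun s => u s)

/-- `IsProcessLaw S φ ν P`: `P` is the law, on the canonical path space `(X × U)^ℕ`, of a process
`(X, u)` generated by the system `S` under the policy `φ` from the initial distribution `ν`.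
That is, `X_0` has law `ν`; the controls are those prescribed by `φ`; and for each `t` the
conditional distribution of `X_{t+1}` given the history `(X_s, u_s)_{s ≤ t}` is `T(X_t, ·)`, where
`T` is chosen from the collection of the action `u_t` (the choice may depend on the time and on
the realized history). -/
def IsProcessLaw {X U AP : Type*} [MeasurableSpace X] [MeasurableSpace U]
    (S : ControlledMarkovSystem X U AP) (φ : Policy X U) (ν : Measure X)
    (P : Measure (ℕ → X × U)) : Prop :=
  IsProbabilityMeasure P ∧
  P.map (fun ω => (ω 0).1) = ν ∧
  (∀ t, ∀ᵐ ω ∂P, (ω t).2 = φ.at t (fun s => (ω s).1) (fun s => (ω s).2)) ∧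
  ∀ t : ℕ, ∃ K : MarkovKernel (Fin (t + 1) → X × U) X,
    (∀ h, ∃ T ∈ S.trans (h (Fin.last t)).2, K.1 h = T.1 (h (Fin.last t)).1) ∧
    P.map (fun ω => ((fun s : Fin (t + 1) => ω s), (ω (t + 1)).1)) =
      (P.map (fun ω => (fun s : Fin (t + 1) => ω s))) ⊗ₘ K.1

/-! ### Linear-time properties -/

/-- `Ψ` is an ω-regular set of infinite words: it is the language of a nondeterministic Büchi
automaton with finitely many states. -/
def IsOmegaRegular {A : Type*} (Ψ : Set (ℕ → A)) : Prop :=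
  ∃ (S : Type) (_ : Finite S) (init acc : Set S) (step : S → A → Set S),
    Ψ = {w | ∃ r : ℕ → S, r 0 ∈ init ∧ (∀ t, r (t + 1) ∈ step (r t) (w t)) ∧
      ∀ m, ∃ t ≥ m, r t ∈ acc}

/-- The event that the trace of the path of states satisfies `Ψ`. -/
def satEvent {X U AP : Type*} [MeasurableSpace X] (S : ControlledMarkovSystem X U AP)
    (Ψ : Set (ℕ → Set AP)) : Set (ℕ → X × U) :=
  {ω | (fun t => S.label (ω t).1) ∈ Ψ}

/-! ### Abstractions -/

/-- The clause shared by the definitions of abstraction and of implementation: action `u` of `XU`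
matches action `a` of `IA` at the abstract state `i`. -/
def ActionMatches {X U Q Act AP : Type*} [MeasurableSpace X] [MeasurableSpace Q]
    (XU : ControlledMarkovSystem X U AP) (IA : ControlledMarkovSystem Q Act AP)
    (α : Set (X × Q)) (Sα : Set (ProbabilityMeasure X × ProbabilityMeasure Q))
    (u : U) (a : Act) (i : Q) : Prop :=
  ∀ T ∈ XU.trans u, ∀ x, (x, i) ∈ α → ∃ Θ ∈ IA.trans a,
    (T.row x, Θ.row i) ∈ Sα ∧ ∀ j, T.1 x {y | (y, j) ∈ α} = Θ.1 i {j}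

/-- `IA` abstracts `XU` through the state-level relation `α` and the measure-level relation `Sα`. -/
def Abstracts {X U Q Act AP : Type*} [MeasurableSpace X] [MeasurableSpace Q]
    (XU : ControlledMarkovSystem X U AP) (IA : ControlledMarkovSystem Q Act AP)
    (α : Set (X × Q)) (Sα : Set (ProbabilityMeasure X × ProbabilityMeasure Q)) : Prop :=
  (∀ x, ∃ q, (x, q) ∈ α ∧ IA.label q = XU.label x) ∧
  ∀ (i : Q) (a : Act), ∃ u : U, ActionMatches XU IA α Sα u a i

/-- `α` comes from a partition of the state space into measurable cells `α⁻¹(q)`, compatible with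
the decomposition into working space and out-of-domain states. -/
def IsPartition {X U Q Act AP : Type*} [MeasurableSpace X] [MeasurableSpace Q]
    (XU : ControlledMarkovSystem X U AP) (IA : ControlledMarkovSystem Q Act AP)
    (α : Set (X × Q)) : Prop :=
  (∀ x, ∃! q, (x, q) ∈ α) ∧
  (∀ q, MeasurableSet {x | (x, q) ∈ α}) ∧
  ∀ x q, (x, q) ∈ α → (x ∈ XU.W ↔ q ∈ IA.W)

/-- `φ` is a `Sα`-implementation of `κ`: whenever `u_t` is the control realized by `φ` along a path
of `XU` and `a_t` the action realized by `κ` along an `α`-related path of `IA`, the control `u_t`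
matches `a_t` at the current abstract state. -/
def IsImplementation {X U Q Act AP : Type*} [MeasurableSpace X] [MeasurableSpace U]
    [MeasurableSpace Q] [MeasurableSpace Act]
    (XU : ControlledMarkovSystem X U AP) (IA : ControlledMarkovSystem Q Act AP)
    (α : Set (X × Q)) (Sα : Set (ProbabilityMeasure X × ProbabilityMeasure Q))
    (φ : Policy X U) (κ : Policy Q Act) : Prop :=
  ∀ (t : ℕ) (x : ℕ → X) (u : ℕ → U) (q : ℕ → Q) (a : ℕ → Act),
    (∀ s ≤ t, (x s, q s) ∈ α) → (∀ s ≤ t, u s = φ.at s x u) → (∀ s ≤ t, a s = κ.at s q a) →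
    ActionMatches XU IA α Sα (u t) (a t) (q t)

/-! ### Bounded-parameter Markov decision processes -/

/-- A BMDP with states `Q`, one of which is the out-of-domain state `out`. -/
structure BMDP (Q Act AP : Type*) where
  out : Q
  lower : Act → Matrix Q Q ℝ
  upper : Act → Matrix Q Q ℝ
  label : Q → Set AP

/-- The controlled Markov system generated by a BMDP: the collection of `a` consists of all
stochastic matrices that lie entrywise between the two bounds of `a`. -/
def BMDP.toSystem {Q Act AP : Type*} [MeasurableSpace Q] [DiscreteMeasurableSpace Q]
    (B : BMDP Q Act AP) : ControlledMarkovSystem Q Act AP where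
  W := {q | q ≠ B.out}
  trans a := {Θ | ∀ i j, B.lower a i j ≤ Θ.toMatrix i j ∧ Θ.toMatrix i j ≤ B.upper a i j}
  label := B.label
  measurable_label := .of_discrete

/-! ### The stochastic difference equation -/

/-- The data of `X_{t+1} = f(X_t, u_t) + b(X_t) w_t + ϑ ξ_t` on `ℝⁿ` (with the maximum norm of
`Fin n → ℝ`), with controls in the compact set `U`, observed in the bounded working space `W`. -/
structure StochasticDifferenceEquation (n p k : ℕ) (AP : Type*) where
  f : (Fin n → ℝ) → (Fin p → ℝ) → (Fin n → ℝ)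
  b : (Fin n → ℝ) → Matrix (Fin n) (Fin k) ℝ
  ϑ : ℝ
  U : Set (Fin p → ℝ)
  W : Set (Fin n → ℝ)
  label : (Fin n → ℝ) → Set AP
  locallyLipschitz_f : LocallyLipschitz fun z : (Fin n → ℝ) × (Fin p → ℝ) => f z.1 z.2
  locallyLipschitz_b : LocallyLipschitz fun x => (fun i j => b x i j : Fin n → Fin k → ℝ)
  nonneg_ϑ : 0 ≤ ϑ
  isCompact_U : IsCompact U
  isBounded_W : Bornology.IsBounded W
  measurableSet_W : MeasurableSet W
  measurable_label : Measurable label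

/-- The law of `f(x, u) + b(x) w + ϑ ξ`, where `w` is a standard Gaussian vector and `ξ` is
independent of `w` with law `ρ`. -/
noncomputable def StochasticDifferenceEquation.stepLaw {n p k : ℕ} {AP : Type*}
    (E : StochasticDifferenceEquation n p k AP) (ρ : Measure (Fin n → ℝ))
    (u : Fin p → ℝ) (x : Fin n → ℝ) : Measure (Fin n → ℝ) :=
  ((Measure.pi fun _ : Fin k => gaussianReal 0 1).prod ρ).map
    fun z => E.f x u + (E.b x).mulVec z.1 + E.ϑ • z.2

/-- The controlled Markov system of the equation, stopped on leaving `W`. The collection of `u`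
consists of the kernels obtained from all laws `ρ` of the perturbation with `𝔼|ξ| ≤ 1`. -/
def StochasticDifferenceEquation.toSystem {n p k : ℕ} {AP : Type*}
    (E : StochasticDifferenceEquation n p k AP) :
    ControlledMarkovSystem (Fin n → ℝ) E.U AP where
  W := E.W
  trans u := {T | ∃ ρ : Measure (Fin n → ℝ), IsProbabilityMeasure ρ ∧ ∫⁻ ξ, ‖ξ‖ₑ ∂ρ ≤ 1 ∧
    (∀ x ∈ E.W, T.1 x = E.stepLaw ρ u x) ∧ ∀ x ∉ E.W, T.1 x = Measure.dirac x}
  label := E.label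
  measurable_label := E.measurable_label

/-!
A run of a Büchi automaton with finitely many states visits the accepting set infinitely often if
and only if there are a state `q` and a position `n` such that `q` is reached at `n` and, for
arbitrarily large `m`, the word between `n` and `m` leads from `q` back to `q` through an accepting
state, while `n` and `m` are *merged*: the automaton restarted from `q` at `n` and at `m` eventually
reaches the same states. Merging lets such loops at `n` be chained one after the other; conversely,
along an accepting run an ultrafilter and the pigeonhole principle produce infinitely many positions
that are pairwise merged. This is a countable Boolean combination of conditions on finite prefixes,
so ω-regular sets are Borel.

The policy `φ` looks up the cells of the states it has seen, and applies a control that matches the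
action that `κ` realizes along them. Under `φ`, the abstract state that follows a given abstract
history is distributed according to an average of rows that the bounds allow. The bounds are
intervals, hence convex, so the average obeys them as well, and the abstract path is a process of
the BMDP with the same trace.
-/

/-! ### Büchi automata -/

section OmegaRegular

variable {A S : Type*}

/-- The automaton of the runs of a Büchi automaton from `q₀`, with a flag that may be raised once
the run has entered `acc`. Its `eval` is the set of pairs (state, flag) reachable along a finite
word; the flag ignores the initial state, so that flags of consecutive segments combine. -/
def visitNFA (q₀ : S) (acc : Set S) (step : S → A → Set S) : NFA A (S × Bool) where
  step x a := {y | y.1 ∈ step x.1 a ∧ (y.2 = true → x.2 = true ∨ y.1 ∈ acc)}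
  start := {(q₀, false)}
  accept := {x | x.2 = true}

/-- The word `w n, …, w (m - 1)`. -/
def wordSegment (w : ℕ → A) (n m : ℕ) : List A :=
  (List.Ico n m).map w

theorem wordSegment_append (w : ℕ → A) {n m k : ℕ} (hnm : n ≤ m) (hmk : m ≤ k) :
    wordSegment w n m ++ wordSegment w m k = wordSegment w n k := by
  rw [wordSegment, wordSegment, ← List.map_append, List.Ico.append_consecutive hnm hmk, wordSegment]

theorem wordSegment_succ (w : ℕ → A) {n m : ℕ} (hnm : n ≤ m) :
    wordSegment w n (m + 1) = wordSegment w n m ++ [w m] := by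
  rw [wordSegment, List.Ico.succ_top hnm, List.map_append, List.map_singleton, wordSegment]

theorem eval_wordSegment_eq_of_le {σ : Type*} (M : NFA A σ) {w : ℕ → A} {n m k l : ℕ}
    (hn : n ≤ k) (hm : m ≤ k) (hkl : k ≤ l)
    (h : M.eval (wordSegment w n k) = M.eval (wordSegment w m k)) :
    M.eval (wordSegment w n l) = M.eval (wordSegment w m l) := by
  rw [← wordSegment_append w hn hkl, ← wordSegment_append w hm hkl, NFA.eval, NFA.evalFrom_append,
    NFA.evalFrom_append]
  exact congrArg (M.evalFrom · _) h

theorem exists_run_of_mem_eval_visitNFA {q₀ : S} {acc : Set S} {step : S → A → Set S} {w : ℕ → A}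
    {n m : ℕ} (hnm : n ≤ m) {q : S} {b : Bool}
    (h : (q, b) ∈ (visitNFA q₀ acc step).eval (wordSegment w n m)) :
    ∃ r : ℕ → S, r n = q₀ ∧ r m = q ∧ (∀ t ∈ Set.Ico n m, r (t + 1) ∈ step (r t) (w t)) ∧
      (b = true → ∃ t ∈ Set.Ioc n m, r t ∈ acc) := by
  induction m, hnm using Nat.le_induction generalizing q b with
  | base =>
    simp only [wordSegment, List.Ico.self_empty, List.map_nil, NFA.eval_nil] at h
    obtain ⟨rfl, rfl⟩ := Prod.mk.inj h
    exact ⟨fun _ => q, rfl, rfl, by simp, by simp⟩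
  | succ m hnm ih =>
    rw [wordSegment_succ w hnm, NFA.eval_append_singleton, NFA.mem_stepSet] at h
    obtain ⟨⟨p, c⟩, hp, hq, hb⟩ := h
    obtain ⟨r, hinit, rfl, hrun, hc⟩ := ih hp
    have hold {t : ℕ} (ht : t ≤ m) : Function.update r (m + 1) q t = r t :=
      Function.update_of_ne (by lia) _ _
    have hnew : Function.update r (m + 1) q (m + 1) = q := Function.update_self ..
    refine ⟨Function.update r (m + 1) q, by rwa [hold hnm], hnew, fun t ht => ?_, fun h => ?_⟩
    · rcases (Nat.lt_succ_iff.1 ht.2).lt_or_eq with htm | rfl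
      · rw [hold htm, hold htm.le]
        exact hrun t ⟨ht.1, htm⟩
      · rwa [hnew, hold le_rfl]
    · rcases hb h with h | h
      · obtain ⟨t, ht, hacc⟩ := hc h
        exact ⟨t, ⟨ht.1, ht.2.trans m.le_succ⟩, by rwa [hold ht.2]⟩
      · exact ⟨m + 1, ⟨Nat.lt_succ_of_le hnm, le_rfl⟩, by rwa [hnew]⟩

theorem mem_eval_visitNFA_of_run {acc : Set S} {step : S → A → Set S} {w : ℕ → A}
    {n m : ℕ} (hnm : n ≤ m) {r : ℕ → S}
    (hrun : ∀ t ∈ Set.Ico n m, r (t + 1) ∈ step (r t) (w t)) {b : Bool}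
    (hb : b = true → ∃ t ∈ Set.Ioc n m, r t ∈ acc) :
    (r m, b) ∈ (visitNFA (r n) acc step).eval (wordSegment w n m) := by
  classical
  induction m, hnm using Nat.le_induction generalizing b with
  | base =>
    simp only [wordSegment, List.Ico.self_empty, List.map_nil, NFA.eval_nil]
    exact Prod.ext rfl (by simpa using hb)
  | succ m hnm ih =>
    rw [wordSegment_succ w hnm, NFA.eval_append_singleton, NFA.mem_stepSet]
    refine ⟨(r m, decide (∃ t ∈ Set.Ioc n m, r t ∈ acc)),
      ih (fun t ht => hrun t ⟨ht.1, ht.2.trans m.lt_succ_self⟩) of_decide_eq_true,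
      hrun m ⟨hnm, m.lt_succ_self⟩, fun h => ?_⟩
    obtain ⟨t, ht, hacc⟩ := hb h
    rcases ht.2.lt_or_eq with htm | rfl
    · exact .inl (decide_eq_true ⟨t, ⟨ht.1, Nat.lt_succ_iff.1 htm⟩, hacc⟩)
    · exact .inr hacc

theorem exists_mem_Ico_of_strictMono {c : ℕ → ℕ} (hc : StrictMono c) {t : ℕ} (ht : c 0 ≤ t) :
    ∃ i, t ∈ Set.Ico (c i) (c (i + 1)) :=
  Set.mem_iUnion.1 ((iUnion_Ico_map_succ_eq_Ici (fun i => hc.monotone i.zero_le)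
    hc.not_bddAbove_range_of_wellFoundedLT).ge ht)

theorem exists_forall_eq_on_Icc_of_strictMono {c : ℕ → ℕ} (hc : StrictMono c) (seg : ℕ → ℕ → S)
    (hseg : ∀ i, seg i (c (i + 1)) = seg (i + 1) (c (i + 1))) :
    ∃ r : ℕ → S, ∀ i, ∀ t ∈ Set.Icc (c i) (c (i + 1)), r t = seg i t := by
  have hcover (t : ℕ) : ∃ i, c 0 ≤ t → t ∈ Set.Ico (c i) (c (i + 1)) := by
    by_cases ht : c 0 ≤ t
    · exact (exists_mem_Ico_of_strictMono hc ht).imp fun _ h _ => h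
    · exact ⟨0, fun h => absurd h ht⟩
  choose idx hidx using hcover
  have idx_eq {i t : ℕ} (ht : t ∈ Set.Ico (c i) (c (i + 1))) : idx t = i := by
    have h := hidx t ((hc.monotone i.zero_le).trans ht.1)
    have h1 := hc.lt_iff_lt.1 (h.1.trans_lt ht.2)
    have h2 := hc.lt_iff_lt.1 (ht.1.trans_lt h.2)
    lia
  refine ⟨fun t => seg (idx t) t, fun i t ht => ?_⟩
  rcases ht.2.lt_or_eq with h | rfl
  · simp only [idx_eq ⟨ht.1, h⟩]
  · simp only [idx_eq ⟨le_rfl, hc (i + 1).lt_succ_self⟩, hseg]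

theorem exists_run_of_forall_mem_eval_visitNFA {acc : Set S} {step : S → A → Set S} {w : ℕ → A}
    {p : ℕ → S} {b : ℕ → Bool} {c : ℕ → ℕ} (hc : StrictMono c) (h0 : c 0 = 0)
    (hp : ∀ i, (p (i + 1), b i) ∈
      (visitNFA (p i) acc step).eval (wordSegment w (c i) (c (i + 1))))
    (hb : ∀ i, b (i + 1) = true) :
    ∃ r : ℕ → S, r 0 = p 0 ∧ (∀ t, r (t + 1) ∈ step (r t) (w t)) ∧ ∀ m, ∃ t ≥ m, r t ∈ acc := by
  choose seg hfst hlast hrun hacc using fun i =>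
    exists_run_of_mem_eval_visitNFA (hc i.lt_succ_self).le (hp i)
  obtain ⟨r, hr⟩ := exists_forall_eq_on_Icc_of_strictMono hc seg fun i =>
    (hlast i).trans (hfst (i + 1)).symm
  refine ⟨r, ?_, fun t => ?_, fun m => ?_⟩
  · have h := hr 0 (c 0) ⟨le_rfl, (hc Nat.zero_lt_one).le⟩
    rwa [hfst 0, h0] at h
  · obtain ⟨i, ht⟩ := exists_mem_Ico_of_strictMono hc (h0.trans_le t.zero_le)
    rw [hr i t ⟨ht.1, ht.2.le⟩, hr i (t + 1) ⟨ht.1.trans t.le_succ, ht.2⟩]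
    exact hrun i t ht
  · obtain ⟨t, ht, htacc⟩ := hacc (m + 1) (hb m)
    exact ⟨t, m.le_succ.trans (hc.le_apply.trans ht.1.le),
      by rwa [hr (m + 1) t ⟨ht.1.le, ht.2⟩]⟩

theorem exists_infinite_pairwise_frequently_eq {ι κ β : Type*} [Infinite ι] [Finite β]
    (f : ι → κ → β) (l : Filter κ) [l.NeBot] :
    ∃ M : Set ι, M.Infinite ∧ ∀ i ∈ M, ∀ j ∈ M, ∃ᶠ k in l, f i k = f j k := by
  have hlim (i : ι) : ∃ b, ∀ᶠ k in (Ultrafilter.of l : Filter κ), f i k = b :=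
    Ultrafilter.eventually_exists_iff.1 (.of_forall fun k => ⟨f i k, rfl⟩)
  choose D hD using hlim
  obtain ⟨b, hb⟩ := Finite.exists_infinite_fiber D
  refine ⟨D ⁻¹' {b}, Set.infinite_coe_iff.1 hb, fun i hi j hj => ?_⟩
  refine Filter.Frequently.filter_mono (Filter.Eventually.frequently ?_) (Ultrafilter.of_le l)
  filter_upwards [hD i, hD j] with k hki hkj
  rw [hki, hkj, hi, hj]

/-- The positions `n` and `m` of `w` are merged: from some later position on, `M` reaches the same
states whether it starts reading `w` at `n` or at `m`. -/
def AreMerged {σ : Type*} (M : NFA A σ) (w : ℕ → A) (n m : ℕ) : Prop :=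
  ∃ k ≥ m, M.eval (wordSegment w n k) = M.eval (wordSegment w m k)

theorem exists_areMerged_of_run [Finite S] {acc : Set S} {step : S → A → Set S} {w : ℕ → A}
    {r : ℕ → S} (hrun : ∀ t, r (t + 1) ∈ step (r t) (w t)) (hacc : ∀ m, ∃ t ≥ m, r t ∈ acc) :
    ∃ n > 0, ∀ N, ∃ m > N, AreMerged (visitNFA (r n) acc step) w n m ∧
      (r n, true) ∈ (visitNFA (r n) acc step).eval (wordSegment w n m) := by
  obtain ⟨M, hM, hmerge⟩ := exists_infinite_pairwise_frequently_eq
    (fun n k => (r n, (visitNFA (r n) acc step).eval (wordSegment w n k))) Filter.atTop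
  obtain ⟨n, hnM, hn⟩ := hM.exists_gt 0
  refine ⟨n, hn, fun N => ?_⟩
  obtain ⟨t, hnt, ht⟩ := hacc (n + 1)
  obtain ⟨m, hmM, hm⟩ := hM.exists_gt (max N t)
  have htm : t < m := (le_max_right N t).trans_lt hm
  obtain ⟨k, hmk, hk⟩ := Filter.frequently_atTop.1 (hmerge n hnM m hmM) m
  obtain ⟨hr, heval⟩ : r n = r m ∧ _ := Prod.mk.injEq .. ▸ hk
  refine ⟨m, (le_max_left N t).trans_lt hm, ⟨k, hmk, ?_⟩, ?_⟩
  · rwa [← hr] at heval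
  · exact hr.symm ▸ mem_eval_visitNFA_of_run (Nat.le_of_succ_le (hnt.trans htm.le))
      (fun t _ => hrun t) fun _ => ⟨t, ⟨hnt, htm.le⟩, ht⟩

theorem exists_run_of_areMerged {acc : Set S} {step : S → A → Set S} {w : ℕ → A} {q₀ q : S}
    {n : ℕ} (hn : 0 < n) (hq : (q, false) ∈ (visitNFA q₀ acc step).eval (wordSegment w 0 n))
    (hmerge : ∀ N, ∃ m > N, AreMerged (visitNFA q acc step) w n m ∧
      (q, true) ∈ (visitNFA q acc step).eval (wordSegment w n m)) :
    ∃ r : ℕ → S, r 0 = q₀ ∧ (∀ t, r (t + 1) ∈ step (r t) (w t)) ∧ ∀ m, ∃ t ≥ m, r t ∈ acc := by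
  have hnext (d : {d // n ≤ d ∧ AreMerged (visitNFA q acc step) w n d}) :
      ∃ d' : {d // n ≤ d ∧ AreMerged (visitNFA q acc step) w n d}, d.1 < d'.1 ∧
        (q, true) ∈ (visitNFA q acc step).eval (wordSegment w d d') := by
    obtain ⟨d, hnd, k, hdk, hk⟩ := d
    obtain ⟨m, hkm, hm, hmem⟩ := hmerge k
    refine ⟨⟨m, hnd.trans (hdk.trans hkm.le), hm⟩, hdk.trans_lt hkm, ?_⟩
    rwa [← eval_wordSegment_eq_of_le _ (hnd.trans hdk) hdk hkm.le hk]
  choose next hlt hmem using hnext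
  let d (i : ℕ) : ℕ := next^[i] ⟨n, le_rfl, n, le_rfl, rfl⟩
  have hd (i : ℕ) : d i < d (i + 1) ∧
      (q, true) ∈ (visitNFA q acc step).eval (wordSegment w (d i) (d (i + 1))) := by
    simp only [d, Function.iterate_succ_apply']
    exact ⟨hlt _, hmem _⟩
  let c : ℕ → ℕ := fun | 0 => 0 | i + 1 => d i
  let p : ℕ → S := fun | 0 => q₀ | _ + 1 => q
  let b : ℕ → Bool := fun | 0 => false | _ + 1 => true
  have hc : StrictMono c := strictMono_nat_of_lt_succ fun | 0 => hn | i + 1 => (hd i).1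
  exact exists_run_of_forall_mem_eval_visitNFA (p := p) (b := b) hc rfl
    (fun | 0 => hq | i + 1 => (hd i).2) fun _ => rfl

theorem exists_accepting_run_iff [Finite S] {init acc : Set S} {step : S → A → Set S} {w : ℕ → A} :
    (∃ r : ℕ → S, r 0 ∈ init ∧ (∀ t, r (t + 1) ∈ step (r t) (w t)) ∧ ∀ m, ∃ t ≥ m, r t ∈ acc) ↔
      ∃ q₀ ∈ init, ∃ q, ∃ n > 0,
        (q, false) ∈ (visitNFA q₀ acc step).eval (wordSegment w 0 n) ∧
        ∀ N, ∃ m > N, AreMerged (visitNFA q acc step) w n m ∧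
          (q, true) ∈ (visitNFA q acc step).eval (wordSegment w n m) := by
  constructor
  · rintro ⟨r, hinit, hrun, hacc⟩
    obtain ⟨n, hn, hmerge⟩ := exists_areMerged_of_run hrun hacc
    have hn₀ : (r n, false) ∈ (visitNFA (r 0) acc step).eval (wordSegment w 0 n) :=
      mem_eval_visitNFA_of_run n.zero_le (fun t _ => hrun t) (by simp)
    exact ⟨r 0, hinit, r n, n, hn, hn₀, hmerge⟩
  · rintro ⟨q₀, hinit, q, n, hn, hq, hmerge⟩
    obtain ⟨r, rfl, hrun, hacc⟩ := exists_run_of_areMerged hn hq hmerge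
    exact ⟨r, hinit, hrun, hacc⟩

section Measurability

variable [MeasurableSpace A] [DiscreteMeasurableSpace A]

theorem measurable_evalFrom_map {ι σ : Type*} [Finite σ] (M : NFA A σ) (D : Set σ) (l : List ι) :
    Measurable fun w : ι → A => M.evalFrom D (l.map w) := by
  induction l using List.reverseRecOn with
  | nil => exact measurable_const
  | append_singleton l i ih =>
    have hstep : Measurable fun z : Set σ × A => M.stepSet z.1 z.2 :=
      measurable_from_prod_countable_right fun _ => .of_discrete
    simp only [List.map_append, List.map_singleton, NFA.evalFrom_append, NFA.evalFrom_singleton]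
    exact hstep.comp (ih.prodMk (measurable_pi_apply i))

theorem measurable_eval_wordSegment {σ : Type*} [Finite σ] (M : NFA A σ) (n m : ℕ) :
    Measurable fun w : ℕ → A => M.eval (wordSegment w n m) :=
  measurable_evalFrom_map M M.start (List.Ico n m)

theorem IsOmegaRegular.measurableSet {Ψ : Set (ℕ → A)} (hΨ : IsOmegaRegular Ψ) :
    MeasurableSet Ψ := by
  obtain ⟨S, _, init, acc, step, rfl⟩ := hΨ
  have measurable_mem (x : S × Bool) (q : S) (n m : ℕ) : Measurable fun w : ℕ → A =>
      x ∈ (visitNFA q acc step).eval (wordSegment w n m) :=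
    (measurable_set_mem x).comp (measurable_eval_wordSegment _ n m)
  have measurable_areMerged (q : S) (n m : ℕ) :
      Measurable fun w : ℕ → A => AreMerged (visitNFA q acc step) w n m :=
    .exists fun k => measurable_const.and <| .eq
      (measurable_eval_wordSegment _ n k) (measurable_eval_wordSegment _ m k)
  simp only [exists_accepting_run_iff]
  exact measurableSet_setOfPred.2 <| .exists fun q₀ => measurable_const.and <| .exists fun q =>
    .exists fun n => measurable_const.and <| (measurable_mem _ q₀ 0 n).and <| .forall fun N =>
      .exists fun m => measurable_const.and <|
        (measurable_areMerged q n m).and (measurable_mem _ q n m)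

end Measurability

end OmegaRegular

/-! ### Policies along paths -/

section Policy

variable {X U Q Act : Type*} [MeasurableSpace X] [MeasurableSpace U] [MeasurableSpace Q]
  [MeasurableSpace Act]

/-- The control that a policy realizes at time `t` along the states `x_0, …, x_t`, when the previous
controls are those realized along the shorter histories. -/
noncomputable def Policy.realized (κ : Policy X U) (t : ℕ) (x : Fin (t + 1) → X) : U :=
  κ.act t x fun s => κ.realized s fun r => x (r.castLE (Nat.succ_le_succ s.2.le))
termination_by t
decreasing_by exact s.2

theorem Policy.at_realized (κ : Policy X U) (t : ℕ) (x : ℕ → X) :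
    κ.at t x (fun s => κ.realized s fun r => x r) = κ.realized t fun s => x s := by
  rw [Policy.realized, Policy.at]
  rfl

theorem Policy.eq_realized (κ : Policy X U) {t : ℕ} {x : ℕ → X} {u : ℕ → U}
    (h : ∀ s ≤ t, u s = κ.at s x u) : u t = κ.realized t fun s => x s := by
  induction t using Nat.strong_induction_on with
  | _ t ih =>
    have hpast : (fun s : Fin t => u s) = fun s : Fin t => κ.realized s fun r => x r :=
      funext fun s => ih s s.2 fun r hr => h r (hr.trans s.2.le)
    rw [h t le_rfl, ← κ.at_realized, Policy.at, Policy.at, hpast]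

theorem Policy.measurable_realized (κ : Policy X U) (t : ℕ) : Measurable (κ.realized t) := by
  induction t using Nat.strong_induction_on with
  | _ t ih =>
    have hpast : Measurable fun (x : Fin (t + 1) → X) (s : Fin t) =>
        κ.realized s fun r => x (r.castLE (Nat.succ_le_succ s.2.le)) :=
      measurable_pi_lambda _ fun s => (ih s s.2).comp (by fun_prop)
    rw [funext (Policy.realized.eq_def κ t)]
    exact (κ.measurable_act t).comp (measurable_id.prodMk hpast)

theorem Policy.measurableSet_eq_at [MeasurableEq U] (κ : Policy X U) (t : ℕ) :
    MeasurableSet {ω : ℕ → X × U | (ω t).2 = κ.at t (fun s => (ω s).1) fun s => (ω s).2} := by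
  have hhist : Measurable fun ω : ℕ → X × U =>
      ((fun s : Fin (t + 1) => (ω s).1), fun s : Fin t => (ω s).2) := by fun_prop
  exact measurableSet_eq_fun (by fun_prop) ((κ.measurable_act t).comp hhist)

/-- The abstraction of a history: abstract states are given by `cell`, and abstract actions are
those realized by `κ`. -/
noncomputable def abstractHistory (cell : X → Q) (κ : Policy Q Act) {t : ℕ}
    (h : Fin (t + 1) → X × U) (s : Fin (t + 1)) : Q × Act :=
  (cell (h s).1, κ.realized s fun r => cell (h (r.castLE s.2)).1)

/-- The abstraction of a path: abstract states are given by `cell`, and abstract actions are those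
realized by `κ`. -/
noncomputable def abstractPath (cell : X → Q) (κ : Policy Q Act) (ω : ℕ → X × U) (t : ℕ) :
    Q × Act :=
  (cell (ω t).1, κ.realized t fun s => cell (ω s).1)

variable {cell : X → Q}

theorem measurable_abstractHistory (hcell : Measurable cell) (κ : Policy Q Act) (t : ℕ) :
    Measurable (abstractHistory cell κ : (Fin (t + 1) → X × U) → Fin (t + 1) → Q × Act) :=
  measurable_pi_lambda _ fun s => (hcell.comp (by fun_prop)).prodMk <|
    (κ.measurable_realized s).comp (by fun_prop)

theorem measurable_abstractPath (hcell : Measurable cell) (κ : Policy Q Act) :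
    Measurable (abstractPath cell κ : (ℕ → X × U) → ℕ → Q × Act) :=
  measurable_pi_lambda _ fun t => (hcell.comp (by fun_prop)).prodMk <|
    (κ.measurable_realized t).comp (by fun_prop)

/-- The policy that refines `κ` through a choice `m` of controls: at a state of the cell `q` it
applies `m (q, a)`, where `a` is the action that `κ` realizes along the abstract states. -/
noncomputable def Policy.implement (κ : Policy Q Act) (hcell : Measurable cell) {m : Q × Act → U}
    (hm : Measurable m) : Policy X U where
  act t x _ := m (cell (x (Fin.last t)), κ.realized t fun s => cell (x s))
  measurable_act t := hm.comp <| (hcell.comp (by fun_prop)).prodMk <|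
    (κ.measurable_realized t).comp (by fun_prop)

theorem Policy.implement_at (κ : Policy Q Act) (hcell : Measurable cell) {m : Q × Act → U}
    (hm : Measurable m) (t : ℕ) (x : ℕ → X) (u : ℕ → U) :
    (κ.implement hcell hm).at t x u = m (cell (x t), κ.realized t fun s => cell (x s)) :=
  rfl

theorem isImplementation_implement {AP : Type*} {XU : ControlledMarkovSystem X U AP}
    {IA : ControlledMarkovSystem Q Act AP} {Sα : Set (ProbabilityMeasure X × ProbabilityMeasure Q)}
    (κ : Policy Q Act) (hcell : Measurable cell) {m : Q × Act → U} (hm : Measurable m)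
    (hmatch : ∀ z, ActionMatches XU IA cell.graph Sα (m z) z.2 z.1) :
    IsImplementation XU IA cell.graph Sα (κ.implement hcell hm) κ := by
  intro t x u q a hq hu ha
  have hcells : (fun s : Fin (t + 1) => cell (x s)) = fun s : Fin (t + 1) => q s :=
    funext fun s => hq s (Nat.lt_succ_iff.1 s.2)
  have hut : u t = m (q t, a t) := by
    rw [hu t le_rfl, Policy.implement_at, hcells, κ.eq_realized ha]
    exact congrArg (fun i => m (i, _)) (hq t le_rfl)
  exact hut ▸ hmatch (q t, a t)

end Policy

/-! ### Abstraction of process laws -/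

theorem exists_measurable_eq_graph {X Q : Type*} [MeasurableSpace X] [MeasurableSpace Q]
    [Countable Q] {α : Set (X × Q)} (hα : ∀ x, ∃! q, (x, q) ∈ α)
    (hmeas : ∀ q, MeasurableSet {x | (x, q) ∈ α}) :
    ∃ cell : X → Q, Measurable cell ∧ α = cell.graph := by
  obtain ⟨cell, rfl⟩ := ((SetRel.exists_graph_eq_iff α).2 hα).exists
  exact ⟨cell, measurable_to_countable' hmeas, rfl⟩

theorem map_eq_dirac_of_measure_preimage_singleton {X Y : Type*} [MeasurableSpace X]
    [MeasurableSpace Y] [MeasurableSingletonClass Y] {ν : Measure X} [IsProbabilityMeasure ν]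
    {f : X → Y} (hf : Measurable f) {y : Y} (hy : ν (f ⁻¹' {y}) = 1) :
    ν.map f = Measure.dirac y := by
  have hae : f =ᵐ[ν] fun _ => y := (prob_compl_eq_zero_iff (hf (.singleton y))).2 hy
  rw [Measure.map_congr hae, Measure.map_const, measure_univ, one_smul]

theorem condDistrib_comp_real_eq_setAverage {Ω H H' Y : Type*} [MeasurableSpace Ω]
    [MeasurableSpace H] [MeasurableSpace H'] [MeasurableSingletonClass H'] [MeasurableSpace Y]
    [StandardBorelSpace Y] [Nonempty Y] {P : Measure Ω} [IsFiniteMeasure P] {Z : Ω → H} {V : Ω → Y}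
    (hZ : Measurable Z) (hV : Measurable V) {K : Kernel H Y} [IsMarkovKernel K]
    (hK : P.map (fun ω => (Z ω, V ω)) = P.map Z ⊗ₘ K) {F : H → H'} (hF : Measurable F) {h : H'}
    (hh : P.map (F ∘ Z) {h} ≠ 0) {s : Set Y} (hs : MeasurableSet s) :
    (condDistrib V (F ∘ Z) P h).real s = ⨍ ω in (F ∘ Z) ⁻¹' {h}, (K (Z ω)).real s ∂P := by
  have hfiber : MeasurableSet (F ⁻¹' {h}) := hF (.singleton h)
  have hjoint : P.map (fun ω => ((F ∘ Z) ω, V ω)) ({h} ×ˢ s) =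
      ∫⁻ ω in (F ∘ Z) ⁻¹' {h}, K (Z ω) s ∂P := by
    rw [Set.preimage_comp, ← setLIntegral_map hfiber (K.measurable_coe hs) hZ,
      ← Measure.compProd_apply_prod hfiber hs, ← hK,
      Measure.map_apply ((hF.comp hZ).prodMk hV) ((MeasurableSet.singleton h).prod hs),
      Measure.map_apply (hZ.prodMk hV) (hfiber.prod hs)]
    rfl
  have hint : ∫ ω in (F ∘ Z) ⁻¹' {h}, (K (Z ω)).real s ∂P =
      (∫⁻ ω in (F ∘ Z) ⁻¹' {h}, K (Z ω) s ∂P).toReal :=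
    integral_toReal ((K.measurable_coe hs).comp hZ).aemeasurable
      (ae_of_all _ fun _ => measure_lt_top _ _)
  rw [setAverage_eq, hint, ← hjoint, measureReal_def, condDistrib_apply_of_ne_zero hV _ hh,
    ENNReal.toReal_mul, ENNReal.toReal_inv, Measure.map_apply (hF.comp hZ) (.singleton h),
    measureReal_def, smul_eq_mul]

theorem condDistrib_comp_real_mem_of_convex {Ω H H' Y : Type*} [MeasurableSpace Ω]
    [MeasurableSpace H] [MeasurableSpace H'] [MeasurableSingletonClass H'] [MeasurableSpace Y]
    [StandardBorelSpace Y] [Nonempty Y] {P : Measure Ω} [IsFiniteMeasure P] {Z : Ω → H} {V : Ω → Y}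
    (hZ : Measurable Z) (hV : Measurable V) {K : Kernel H Y} [IsMarkovKernel K]
    (hK : P.map (fun ω => (Z ω, V ω)) = P.map Z ⊗ₘ K) {F : H → H'} (hF : Measurable F) {h : H'}
    (hh : P.map (F ∘ Z) {h} ≠ 0) {s : Set Y} (hs : MeasurableSet s) {C : Set ℝ} (hC : Convex ℝ C)
    (hC' : IsClosed C) (hKC : ∀ᵐ ω ∂P, F (Z ω) = h → (K (Z ω)).real s ∈ C) :
    (condDistrib V (F ∘ Z) P h).real s ∈ C := by
  have hFZ : Measurable (F ∘ Z) := hF.comp hZ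
  rw [Measure.map_apply hFZ (.singleton h)] at hh
  have hint : Integrable (fun ω => (K (Z ω)).real s) P :=
    .of_bound ((K.measurable_coe hs).comp hZ).ennreal_toReal.aestronglyMeasurable 1
      (ae_of_all _ fun ω => (Real.norm_of_nonneg measureReal_nonneg).trans_le measureReal_le_one)
  rw [condDistrib_comp_real_eq_setAverage hZ hV hK hF _ hs]
  · exact hC.set_average_mem hC' hh (measure_ne_top _ _)
      ((ae_restrict_iff' (hFZ (.singleton h))).2 hKC) hint.integrableOn
  · rwa [Measure.map_apply hFZ (.singleton h)]

theorem measurableSet_satEvent {X U AP : Type*} [MeasurableSpace X] [MeasurableSpace U]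
    (S : ControlledMarkovSystem X U AP) {Ψ : Set (ℕ → Set AP)} (hΨ : MeasurableSet Ψ) :
    MeasurableSet (satEvent S Ψ) := by
  have htrace : Measurable fun (ω : ℕ → X × U) t => S.label (ω t).1 :=
    measurable_pi_lambda _ fun t => S.measurable_label.comp (by fun_prop)
  exact htrace hΨ

theorem preimage_abstractPath_satEvent {X U Q Act AP : Type*} [MeasurableSpace X]
    [MeasurableSpace Q] [MeasurableSpace Act] {XU : ControlledMarkovSystem X U AP}
    {IA : ControlledMarkovSystem Q Act AP} {cell : X → Q}
    (hlabel : ∀ x, IA.label (cell x) = XU.label x) (κ : Policy Q Act) (Ψ : Set (ℕ → Set AP)) :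
    abstractPath cell κ ⁻¹' satEvent IA Ψ = satEvent XU Ψ := by
  ext ω
  exact iff_of_eq (congrArg (· ∈ Ψ) (funext fun t => hlabel (ω t).1))

theorem BMDP.exists_mem_trans_row_eq {Q Act AP : Type*} [Countable Q] [MeasurableSpace Q]
    [DiscreteMeasurableSpace Q] (B : BMDP Q Act AP) {a : Act} (ha : (B.toSystem.trans a).Nonempty)
    {i : Q} {μ : Measure Q} [IsProbabilityMeasure μ]
    (hμ : ∀ j, μ.real {j} ∈ Set.Icc (B.lower a i j) (B.upper a i j)) :
    ∃ Θ ∈ B.toSystem.trans a, Θ.1 i = μ := by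
  classical
  obtain ⟨Θ, hΘ⟩ := ha
  have hrows (i' : Q) : IsProbabilityMeasure (Function.update Θ.1 i μ i') ∧
      ∀ j, (Function.update Θ.1 i μ i').real {j} ∈ Set.Icc (B.lower a i' j) (B.upper a i' j) := by
    rcases eq_or_ne i' i with rfl | hi
    · rw [Function.update_self]
      exact ⟨inferInstance, hμ⟩
    · rw [Function.update_of_ne hi]
      exact ⟨Θ.2.isProbabilityMeasure i', hΘ i'⟩
  exact ⟨⟨Kernel.ofFunOfCountable (Function.update Θ.1 i μ), ⟨fun i' => (hrows i').1⟩⟩,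
    fun i' => (hrows i').2, Function.update_self (f := Θ.1) ..⟩

theorem IsProcessLaw.trans_nonempty {X U AP : Type*} [MeasurableSpace X] [MeasurableSpace U]
    {S : ControlledMarkovSystem X U AP} {φ : Policy X U} {ν : Measure X} {P : Measure (ℕ → X × U)}
    (hP : IsProcessLaw S φ ν P) (u : U) : (S.trans u).Nonempty := by
  obtain ⟨_, -, -, hstep⟩ := hP
  obtain ⟨ω⟩ := P.nonempty_of_neZero
  obtain ⟨K, hK, -⟩ := hstep 0
  obtain ⟨T, hT, -⟩ := hK fun _ => ((ω 0).1, u)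
  exact ⟨T, hT⟩

theorem BMDP.exists_kernel_ae_eq {Q Act AP H : Type*} [Countable Q] [MeasurableSpace Q]
    [DiscreteMeasurableSpace Q] [Countable H] [MeasurableSpace H] [DiscreteMeasurableSpace H]
    (B : BMDP Q Act AP) (hB : ∀ a, (B.toSystem.trans a).Nonempty) (z : H → Q × Act) {μ : Measure H}
    {η : Kernel H Q} [IsMarkovKernel η]
    (hη : ∀ᵐ h ∂μ, ∀ j, (η h).real {j} ∈
      Set.Icc (B.lower (z h).2 (z h).1 j) (B.upper (z h).2 (z h).1 j)) :
    ∃ K : MarkovKernel H Q, (∀ h, ∃ Θ ∈ B.toSystem.trans (z h).2, K.1 h = Θ.1 (z h).1) ∧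
      K.1 =ᵐ[μ] η := by
  have hrow (h : H) : ∃ Θ ∈ B.toSystem.trans (z h).2, μ {h} ≠ 0 → Θ.1 (z h).1 = η h := by
    by_cases hh : μ {h} = 0
    · obtain ⟨Θ, hΘ⟩ := hB (z h).2
      exact ⟨Θ, hΘ, fun h0 => absurd hh h0⟩
    · obtain ⟨Θ, hΘ, hΘh⟩ := B.exists_mem_trans_row_eq (hB _) (ae_iff_of_countable.1 hη h hh)
      exact ⟨Θ, hΘ, fun _ => hΘh⟩
  choose Θ hΘ hΘh using hrow
  exact ⟨⟨Kernel.ofFunOfCountable fun h => (Θ h).1 (z h).1,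
    ⟨fun h => (Θ h).2.isProbabilityMeasure _⟩⟩, fun h => ⟨Θ h, hΘ h, rfl⟩,
    ae_iff_of_countable.2 hΘh⟩

section Abstraction

variable {X U Q Act AP : Type*} [MeasurableSpace X] [MeasurableSpace U] [Countable Q]
  [MeasurableSpace Q] [MeasurableSpace Act] {XU : ControlledMarkovSystem X U AP}
  {Sα : Set (ProbabilityMeasure X × ProbabilityMeasure Q)} {cell : X → Q} {φ : Policy X U}
  {κ : Policy Q Act} {ν : Measure X} {P : Measure (ℕ → X × U)}

theorem IsProcessLaw.ae_exists_mem_trans_row_eq_map [MeasurableSingletonClass Q]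
    {IA : ControlledMarkovSystem Q Act AP} (hP : IsProcessLaw XU φ ν P) (hcell : Measurable cell)
    (hφ : IsImplementation XU IA cell.graph Sα φ κ) {t : ℕ}
    {K : MarkovKernel (Fin (t + 1) → X × U) X}
    (hK : ∀ h, ∃ T ∈ XU.trans (h (Fin.last t)).2, K.1 h = T.1 (h (Fin.last t)).1) :
    ∀ᵐ ω ∂P, ∃ Θ ∈ IA.trans (abstractPath cell κ ω t).2,
      (K.1 fun s => ω s).map cell = Θ.1 (abstractPath cell κ ω t).1 := by
  obtain ⟨-, -, hctrl, -⟩ := hP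
  filter_upwards [ae_all_iff.2 hctrl] with ω hω
  obtain ⟨T, hT, hKT⟩ := hK fun s => ω s
  obtain ⟨Θ, hΘ, -, hTΘ⟩ := hφ t (fun s => (ω s).1) (fun s => (ω s).2)
    (fun s => (abstractPath cell κ ω s).1) (fun s => (abstractPath cell κ ω s).2)
    (fun _ _ => rfl) (fun s _ => hω s)
    (fun s _ => (κ.at_realized s fun r => cell (ω r).1).symm) T hT _ rfl
  refine ⟨Θ, hΘ, Measure.ext_of_singleton fun j => ?_⟩
  rw [Measure.map_apply hcell (.singleton j), hKT]
  exact hTΘ j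

variable [DiscreteMeasurableSpace Q] [Countable Act] [DiscreteMeasurableSpace Act]
  {B : BMDP Q Act AP}

theorem IsProcessLaw.exists_kernel_abstractHistory [Nonempty Q] (hP : IsProcessLaw XU φ ν P)
    (hcell : Measurable cell) (hφ : IsImplementation XU B.toSystem cell.graph Sα φ κ)
    (hB : ∀ a, (B.toSystem.trans a).Nonempty) (t : ℕ) :
    ∃ K : MarkovKernel (Fin (t + 1) → Q × Act) Q,
      (∀ h, ∃ Θ ∈ B.toSystem.trans (h (Fin.last t)).2, K.1 h = Θ.1 (h (Fin.last t)).1) ∧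
      P.map (fun ω => (abstractHistory cell κ fun s : Fin (t + 1) => ω s, cell (ω (t + 1)).1)) =
        P.map (fun ω => abstractHistory cell κ fun s : Fin (t + 1) => ω s) ⊗ₘ K.1 := by
  have := hP.1
  obtain ⟨K, hKtrans, hK⟩ := hP.2.2.2 t
  have := K.2
  let Z : (ℕ → X × U) → Fin (t + 1) → X × U := fun ω s => ω s
  let V : (ℕ → X × U) → Q := fun ω => cell (ω (t + 1)).1
  have hZ : Measurable Z := by fun_prop
  have hV : Measurable V := hcell.comp (by fun_prop)
  have hF := measurable_abstractHistory (U := U) hcell κ t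
  have hKcell : P.map (fun ω => (Z ω, V ω)) = P.map Z ⊗ₘ K.1.map cell := by
    have hstep : Measurable fun ω : ℕ → X × U => (ω (t + 1)).1 := by fun_prop
    rw [Measure.compProd_map hcell, ← hK,
      Measure.map_map (measurable_id.prodMap hcell) (hZ.prodMk hstep)]
    rfl
  have hbounds : ∀ᵐ h ∂P.map (abstractHistory cell κ ∘ Z), ∀ j,
      (condDistrib V (abstractHistory cell κ ∘ Z) P h).real {j} ∈
        Set.Icc (B.lower (h (Fin.last t)).2 (h (Fin.last t)).1 j)
          (B.upper (h (Fin.last t)).2 (h (Fin.last t)).1 j) := by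
    refine ae_iff_of_countable.2 fun h hh j => ?_
    have := Kernel.IsMarkovKernel.map K.1 hcell
    refine condDistrib_comp_real_mem_of_convex hZ hV hKcell hF hh (.singleton j) (convex_Icc _ _)
      isClosed_Icc ?_
    filter_upwards [hP.ae_exists_mem_trans_row_eq_map hcell hφ hKtrans] with ω hω hωh
    obtain ⟨Θ, hΘ, hrow⟩ := hω
    rw [Kernel.map_apply _ hcell, hrow, ← hωh]
    exact hΘ _ j
  obtain ⟨K', hK', hae⟩ :=
    B.exists_kernel_ae_eq hB (fun h : Fin (t + 1) → Q × Act => h (Fin.last t)) hbounds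
  have := K'.2
  exact ⟨K', hK',
    ((Measure.compProd_congr hae).trans (compProd_map_condDistrib hV.aemeasurable)).symm⟩

theorem IsProcessLaw.map_abstractPath (hP : IsProcessLaw XU φ ν P)
    (hcell : Measurable cell) (hφ : IsImplementation XU B.toSystem cell.graph Sα φ κ)
    (hB : ∀ a, (B.toSystem.trans a).Nonempty) :
    IsProcessLaw B.toSystem κ (ν.map cell) (P.map (abstractPath cell κ)) := by
  have := hP.1
  have hpath : Measurable (abstractPath cell κ : (ℕ → X × U) → ℕ → Q × Act) :=
    measurable_abstractPath hcell κ
  refine ⟨Measure.isProbabilityMeasure_map hpath.aemeasurable, ?_, fun t => ?_, fun t => ?_⟩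
  · rw [Measure.map_map (by fun_prop) hpath, ← hP.2.1, Measure.map_map hcell (by fun_prop)]
    rfl
  · exact (ae_map_iff hpath.aemeasurable (κ.measurableSet_eq_at t)).2
      (ae_of_all _ fun ω => (κ.at_realized t fun s => cell (ω s).1).symm)
  · have := (⟨cell ((P.nonempty_of_neZero).some 0).1⟩ : Nonempty Q)
    rw [Measure.map_map (by fun_prop) hpath, Measure.map_map (by fun_prop) hpath]
    exact hP.exists_kernel_abstractHistory hcell hφ hB t

end Abstraction

theorem mainTheorem1_general {X U Q Act AP : Type*} [MeasurableSpace X] [MeasurableSpace U]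
    [Countable Q] [MeasurableSpace Q] [DiscreteMeasurableSpace Q]
    [Countable Act] [MeasurableSpace Act] [DiscreteMeasurableSpace Act]
    (XU : ControlledMarkovSystem X U AP) (B : BMDP Q Act AP) (α : Set (X × Q))
    (Sα : Set (ProbabilityMeasure X × ProbabilityMeasure Q))
    (hα : ∀ x, ∃! q, (x, q) ∈ α) (hαm : ∀ q, MeasurableSet {x | (x, q) ∈ α})
    (hXU : Abstracts XU B.toSystem α Sα) (ν₀ : Measure X) [IsProbabilityMeasure ν₀]
    (q₀ : Q) (hν₀ : ν₀ {x | (x, q₀) ∈ α} = 1) (κ : Policy Q Act) :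
    ∃ φ : Policy X U, IsImplementation XU B.toSystem α Sα φ κ ∧
      ∀ P, IsProcessLaw XU φ ν₀ P →
        ∃ R, IsProcessLaw B.toSystem κ (Measure.dirac q₀) R ∧
          ∀ Ψ, MeasurableSet Ψ → P.real (satEvent XU Ψ) = R.real (satEvent B.toSystem Ψ) := by
  obtain ⟨cell, hcell, rfl⟩ := exists_measurable_eq_graph hα hαm
  obtain ⟨hlabel, hmatch⟩ := hXU
  choose m hm using fun z : Q × Act => hmatch z.1 z.2
  have hφ := isImplementation_implement κ hcell (.of_discrete (f := m)) hm
  refine ⟨_, hφ, fun P hP => ⟨P.map (abstractPath cell κ), ?_, fun Ψ hΨ => ?_⟩⟩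
  · obtain ⟨x₀⟩ := ν₀.nonempty_of_neZero
    have hB (a : Act) : (B.toSystem.trans a).Nonempty := by
      obtain ⟨T, hT⟩ := hP.trans_nonempty (m (cell x₀, a))
      obtain ⟨Θ, hΘ, -⟩ := hm (cell x₀, a) T hT x₀ rfl
      exact ⟨Θ, hΘ⟩
    exact map_eq_dirac_of_measure_preimage_singleton hcell hν₀ ▸ hP.map_abstractPath hcell hφ hB
  · have hcells (x : X) : B.toSystem.label (cell x) = XU.label x := by
      obtain ⟨_, rfl, hx⟩ := hlabel x
      exact hx
    rw [map_measureReal_apply (measurable_abstractPath hcell κ) (measurableSet_satEvent _ hΨ),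
      preimage_abstractPath_satEvent hcells]

theorem mainTheorem1 {n p k : ℕ} {Q Act AP : Type*} [Finite AP]
    [Finite Q] [MeasurableSpace Q] [DiscreteMeasurableSpace Q]
    [Finite Act] [MeasurableSpace Act] [DiscreteMeasurableSpace Act]
    (E : StochasticDifferenceEquation n p k AP) (B : BMDP Q Act AP)
    (α : Set ((Fin n → ℝ) × Q))
    (Sα : Set (ProbabilityMeasure (Fin n → ℝ) × ProbabilityMeasure Q))
    (hα : IsPartition E.toSystem B.toSystem α)
    (hE : Abstracts E.toSystem B.toSystem α Sα)
    (ν₀ : Measure (Fin n → ℝ)) [IsProbabilityMeasure ν₀]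
    (q₀ : Q) (hν₀ : ν₀ {x | (x, q₀) ∈ α} = 1)
    (κ : Policy Q Act) :
    ∃ φ : Policy (Fin n → ℝ) E.U,
      IsImplementation E.toSystem B.toSystem α Sα φ κ ∧
      ∀ P, IsProcessLaw E.toSystem φ ν₀ P →
        ∀ Ψ : Set (ℕ → Set AP), IsOmegaRegular Ψ →
          MeasurableSet Ψ ∧
          P.real (satEvent E.toSystem Ψ) ∈
            {r : ℝ | ∃ R, IsProcessLaw B.toSystem κ (Measure.dirac q₀) R ∧
              r = R.real (satEvent B.toSystem Ψ)} := by
  obtain ⟨φ, hφ, h⟩ := mainTheorem1_general E.toSystem B α Sα hα.1 hα.2.1 hE ν₀ q₀ hν₀ κ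
  refine ⟨φ, hφ, fun P hP Ψ hΨ => ?_⟩
  obtain ⟨R, hR, hPR⟩ := h P hP
  exact ⟨hΨ.measurableSet, R, hR, hPR Ψ hΨ.measurableSet⟩
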